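/- For each integer $q\ge 0$ let $S_q=\sum_{i=1}^{q}\frac1i-\log(q+1)$, and let $\gamma=\lim_{q\to\infty}S_q$ be Euler's constant. Let $c,m,r$ be positive integers. Then for every positive integer $n$, $$\left|\gamma-\frac{\bigl((2cn)!\bigr)^m}{(2mcn)!\;r^{2mcn}}\sum_{k=0}^{2mcn}(-1)^k\binom{2mcn}{k}\left[\prod_{j=1}^{m}\binom{rk+(2j+1)cn+j}{2cn}\right]S_{rk+2mcn+m}\right|<\frac{m^m}{(m-1)!}\left(\frac{1}{4^{c}\,(r+1)^{2mc+\frac{2mc}{r}}}\right)^{n}.$$ -/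

import Mathlib

/-! ### Pointwise bounds for polynomials in the Euler operator -/

namespace EulerGamma

open Polynomial

/-! The error `γ - S_q` is the integral over `s ∈ (0,1)` and `x ∈ (0,1)` of `x^q (1 - x^s)/(1 - x)`,
and for each `s` the kernel `(1 - x^s)/(1 - x)` is a positive mixture of the functions `w =
t/(x+t)`, `t > 0`. A bound for the moments `∫ x^q w dx`, uniform in `t`, therefore transfers to `γ -
S_q` (`abs_sum_mul_eulerMascheroniConstant_sub_le`).

Put `a = cn` and `N = 2ma`. Up to a constant, the product of binomials is `Q(-(q+1))` for a monic
`Q` of degree `N` (`blockPoly`). Integrating by parts replaces `Q(-(q+1))` by `Q(x d/dx)` acting on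
`w`; the boundary terms have degree below `N` in `q`, so the alternating sum kills them and leaves
`∫ x^K (1 - x^r)^N Q(x d/dx)w dx` (`alternating_sum_eval_mul_moment`). The same difference applied
to `Q` alone gives the normalisation `N! r^N`.

Multiplying `Q` by the missing factors (`gapPoly`) yields a full rising factorial, whose action on
`w` is explicit. A comparison principle then removes the extra factors one by one and bounds `Q(x
d/dx)w` by a constant times `(1-w)^a w^(a+1)` (`abs_eval_blockPoly_le`). The rate comes from `w(1-w)
≤ 1/4` and the maximum of `x(1 - x^r)`. -/

/-- The Euler operator `x d/dx`, written in the coordinate `w = t / (x + t)`, as an operator on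
polynomials in `w`. -/
noncomputable def eulerOp : ℝ[X] →ₗ[ℝ] ℝ[X] :=
  LinearMap.mulLeft ℝ (X ^ 2 - X) ∘ₗ Polynomial.derivative

lemma eulerOp_apply (p : ℝ[X]) : eulerOp p = (X ^ 2 - X) * derivative p := rfl

lemma aeval_mul_eulerOp (P Q p : ℝ[X]) :
    aeval eulerOp (P * Q) p = aeval eulerOp P (aeval eulerOp Q p) := by
  rw [map_mul, Module.End.mul_apply]

lemma aeval_mul_eulerOp' (P Q p : ℝ[X]) :
    aeval eulerOp (P * Q) p = aeval eulerOp Q (aeval eulerOp P p) := by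
  rw [mul_comm, aeval_mul_eulerOp]

lemma aeval_X_add_C_eulerOp (b : ℝ) (p : ℝ[X]) :
    aeval eulerOp (X + C b) p = (X ^ 2 - X) * derivative p + C b * p := by
  simp [eulerOp_apply, Polynomial.C_mul', Module.algebraMap_end_apply]

/-- The falling factorial of `x d/dx` is `x^a (d/dx)^a`, and `1 - w = x/(x+t)`. -/
lemma descPochhammer_eulerOp (a : ℕ) :
    aeval eulerOp (descPochhammer ℝ a) (X : ℝ[X]) =
      C ((-1 : ℝ) ^ a * a.factorial) * ((1 - X) ^ a * X) := by
  induction a with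
  | zero => simp
  | succ a ih =>
    have h : (X - (a : ℝ[X])) = X + C (-(a : ℝ)) := by simp [sub_eq_add_neg]
    rw [descPochhammer_succ_right, aeval_mul_eulerOp', ih, h, aeval_X_add_C_eulerOp]
    cases a with
    | zero => simp; ring
    | succ a =>
      simp [derivative_pow, Nat.factorial_succ]
      ring

/-- The first `a` factors form a falling factorial. Each later one uses `(x d/dx + p)((1-w)^a w^p) =
(a+p)(1-w)^a w^(p+1)`. -/
lemma ascPochhammer_comp_eulerOp (a j : ℕ) :
    aeval eulerOp ((ascPochhammer ℝ (a + j)).comp (X + C (1 - (a : ℝ)))) (X : ℝ[X]) =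
      C ((-1 : ℝ) ^ a * (a + j).factorial) * ((1 - X) ^ a * X ^ (j + 1)) := by
  induction j with
  | zero =>
    have h : (ascPochhammer ℝ a).comp (X + C (1 - (a : ℝ))) = descPochhammer ℝ a := by
      apply Polynomial.funext
      intro x
      rw [descPochhammer_eval_eq_ascPochhammer, eval_comp]
      congr 1
      simp
      ring
    simp only [add_zero, zero_add, pow_one, h, descPochhammer_eulerOp]
  | succ j ih =>
    have h : (X + ((a + j : ℕ) : ℝ[X])).comp (X + C (1 - (a : ℝ))) = X + C ((j : ℝ) + 1) := by
      simp
      ring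
    rw [← add_assoc, ascPochhammer_succ_right, mul_comp, h, aeval_mul_eulerOp', ih,
      aeval_X_add_C_eulerOp]
    cases a with
    | zero => simp [derivative_pow, Nat.factorial_succ]; ring
    | succ a =>
      simp [derivative_pow, Nat.factorial_succ, add_right_comm _ 1 j]
      ring

/-- The product of `m` blocks of `2a` consecutive linear factors, successive blocks being
separated by one missing factor. -/
noncomputable def blockPoly (a m : ℕ) : ℝ[X] :=
  ∏ l ∈ Finset.range m,
    (ascPochhammer ℝ (2 * a)).comp (X + C (1 - (a : ℝ) + l * (2 * a + 1)))

/-- The product of the linear factors that are missing between the blocks of `blockPoly`. -/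
noncomputable def gapPoly (a m : ℕ) : ℝ[X] :=
  ∏ l ∈ Finset.range m, (X + C (((l : ℝ) + 1) * (2 * a + 1) - a))

lemma blockPoly_mul_gapPoly (a m : ℕ) :
    blockPoly a m * gapPoly a m =
      (ascPochhammer ℝ (m * (2 * a + 1))).comp (X + C (1 - (a : ℝ))) := by
  induction m with
  | zero => simp [blockPoly, gapPoly]
  | succ m ih =>
    have h := ascPochhammer_mul ℝ (m * (2 * a + 1)) (2 * a + 1)
    rw [ascPochhammer_succ_right ℝ (2 * a)] at h
    rw [add_mul m 1, one_mul, ← h, mul_comp, ← ih, blockPoly, gapPoly, Finset.prod_range_succ,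
      Finset.prod_range_succ, ← blockPoly, ← gapPoly]
    have h1 : ((ascPochhammer ℝ (2 * a)).comp (X + ((m * (2 * a + 1) : ℕ) : ℝ[X]))).comp
        (X + C (1 - (a : ℝ))) =
        (ascPochhammer ℝ (2 * a)).comp (X + C (1 - (a : ℝ) + m * (2 * a + 1))) := by
      rw [comp_assoc]
      congr 1
      simp [map_ofNat]
      ring
    have h2 : ((X + ((2 * a : ℕ) : ℝ[X])).comp (X + ((m * (2 * a + 1) : ℕ) : ℝ[X]))).comp
        (X + C (1 - (a : ℝ))) = X + C (((m : ℝ) + 1) * (2 * a + 1) - a) := by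
      simp [map_ofNat]
      ring
    rw [mul_comp, mul_comp, h1, h2]
    ring

lemma monic_blockPoly (a m : ℕ) : (blockPoly a m).Monic := by
  refine monic_prod_of_monic _ _ fun l _ => ?_
  refine (monic_ascPochhammer ℝ _).comp (monic_X_add_C _) ?_
  rw [natDegree_X_add_C]
  exact one_ne_zero

lemma natDegree_blockPoly (a m : ℕ) : (blockPoly a m).natDegree = m * (2 * a) := by
  rw [blockPoly, natDegree_prod_of_monic]
  · simp only [natDegree_comp, natDegree_X_add_C, ascPochhammer_natDegree]
    simp
  · refine fun l _ => (monic_ascPochhammer ℝ _).comp (monic_X_add_C _) ?_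
    rw [natDegree_X_add_C]
    exact one_ne_zero

/-- Comparison principle for `eulerOp + b` with `0 < b`, one-sided form. -/
lemma eval_nonneg_of_eulerOp_nonneg {b : ℝ} (hb : 0 < b) {d : ℝ[X]}
    (h : ∀ w ∈ Set.Ioo (0 : ℝ) 1, 0 ≤ (aeval eulerOp (X + C b) d).eval w) :
    ∀ w ∈ Set.Ioo (0 : ℝ) 1, 0 ≤ d.eval w := by
  intro w hw
  -- Since `(1-w)/w = x/t`, this is the integrating factor `(x/t)^b` times `d`; it vanishes at `w =
  -- 1`, that is, at `x = 0`.
  let f : ℝ → ℝ := fun w => (1 - w) ^ b * w ^ (-b) * d.eval w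
  have hderiv : ∀ v ∈ Set.Ioo (0 : ℝ) 1, HasDerivAt f
      (-((1 - v) ^ (b - 1) * v ^ (-b - 1)) * (aeval eulerOp (X + C b) d).eval v) v := by
    intro v hv
    have hv0 : 0 < v := hv.1
    have hv1 : 0 < 1 - v := by linarith [hv.2]
    have h1 : HasDerivAt (fun w : ℝ => (1 - w) ^ b) (-1 * b * (1 - v) ^ (b - 1)) v :=
      ((hasDerivAt_id v).const_sub 1).rpow_const (Or.inl hv1.ne')
    have h2 : HasDerivAt (fun w : ℝ => w ^ (-b)) (1 * (-b) * v ^ (-b - 1)) v :=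
      (hasDerivAt_id v).rpow_const (Or.inl hv0.ne')
    refine ((h1.mul h2).mul (d.hasDerivAt v)).congr_deriv ?_
    have e1 : (1 - v) ^ b = (1 - v) ^ (b - 1) * (1 - v) := by
      rw [← Real.rpow_add_one hv1.ne']; ring_nf
    have e2 : v ^ (-b) = v ^ (-b - 1) * v := by
      rw [← Real.rpow_add_one hv0.ne']; ring_nf
    rw [aeval_X_add_C_eulerOp]
    simp only [e1, e2, eval_add, eval_mul, eval_sub, eval_pow, eval_X, eval_C, Pi.mul_apply]
    ring
  have hcont : ContinuousOn f (Set.Icc w 1) := by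
    refine ContinuousOn.mul (ContinuousOn.mul ?_ ?_) d.continuous.continuousOn
    · exact ContinuousOn.rpow_const (by fun_prop) fun _ _ => Or.inr hb.le
    · exact ContinuousOn.rpow_const (by fun_prop) fun v hv => Or.inl (hw.1.trans_le hv.1).ne'
  have hanti : AntitoneOn f (Set.Icc w 1) := by
    have hsub : ∀ v ∈ interior (Set.Icc w 1), v ∈ Set.Ioo (0 : ℝ) 1 := fun v hv => by
      rw [interior_Icc] at hv
      exact ⟨hw.1.trans hv.1, hv.2⟩
    refine antitoneOn_of_deriv_nonpos (convex_Icc w 1) hcont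
      (fun v hv => (hderiv v (hsub v hv)).differentiableAt.differentiableWithinAt) fun v hv => ?_
    rw [(hderiv v (hsub v hv)).deriv]
    have hv0 : 0 < v := (hsub v hv).1
    have hv1 : 0 < 1 - v := by linarith [(hsub v hv).2]
    have := mul_nonneg (by positivity : 0 ≤ (1 - v) ^ (b - 1) * v ^ (-b - 1)) (h v (hsub v hv))
    linarith
  have hle := hanti (Set.left_mem_Icc.2 hw.2.le) (Set.right_mem_Icc.2 hw.2.le) hw.2.le
  have hf1 : f 1 = 0 := by simp [f, Real.zero_rpow hb.ne']
  rw [hf1] at hle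
  have hw0 : 0 < w := hw.1
  have hw1 : 0 < 1 - w := by linarith [hw.2]
  exact nonneg_of_mul_nonneg_right hle (by positivity)

lemma abs_eval_le_of_eulerOp_le {b : ℝ} (hb : 0 < b) {g F : ℝ[X]}
    (h : ∀ w ∈ Set.Ioo (0 : ℝ) 1,
      |(aeval eulerOp (X + C b) g).eval w| ≤ (aeval eulerOp (X + C b) F).eval w) :
    ∀ w ∈ Set.Ioo (0 : ℝ) 1, |g.eval w| ≤ F.eval w := by
  intro w hw
  have h1 := eval_nonneg_of_eulerOp_nonneg hb (d := F - g) (fun v hv => by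
    rw [map_sub, eval_sub]
    linarith [(abs_le.1 (h v hv)).2]) w hw
  have h2 := eval_nonneg_of_eulerOp_nonneg hb (d := F + g) (fun v hv => by
    rw [map_add, eval_add]
    linarith [(abs_le.1 (h v hv)).1]) w hw
  rw [eval_sub] at h1
  rw [eval_add] at h2
  exact abs_le.2 ⟨by linarith, by linarith⟩

lemma abs_eval_le_of_gap_factor_le (a k : ℕ) {K : ℝ} {g : ℝ[X]}
    (h : ∀ w ∈ Set.Ioo (0 : ℝ) 1,
      |(aeval eulerOp (X + C (((k : ℝ) + 1) * (2 * a + 1) - a)) g).eval w| ≤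
        K * ((1 - w) ^ a * w ^ (k * (2 * a + 1) + a + 2))) :
    ∀ w ∈ Set.Ioo (0 : ℝ) 1, |g.eval w| ≤
      K / ((k + 1) * (2 * a + 1)) * ((1 - w) ^ a * w ^ (k * (2 * a + 1) + a + 1)) := by
  have hb : 0 < ((k : ℝ) + 1) * (2 * a + 1) - a := by
    have : ((k : ℝ) + 1) * (2 * a + 1) - a = k * (2 * a + 1) + a + 1 := by ring
    rw [this]
    positivity
  -- The shift equals the exponent `p = k(2a+1)+a+1` of `w`, so the majorant solves the equation
  -- exactly, with factor `a + p = (k+1)(2a+1)`.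
  have hF : aeval eulerOp (X + C (((k : ℝ) + 1) * (2 * a + 1) - a))
      (C (K / ((k + 1) * (2 * a + 1))) * ((1 - X) ^ a * X ^ (k * (2 * a + 1) + a + 1))) =
      C K * ((1 - X) ^ a * X ^ (k * (2 * a + 1) + a + 2)) := by
    have hK : C K = C (K / ((k + 1) * (2 * a + 1))) * C (((k : ℝ) + 1) * (2 * a + 1)) := by
      rw [← C_mul, div_mul_cancel₀]
      positivity
    rw [aeval_X_add_C_eulerOp, hK]
    cases a with
    | zero => simp [derivative_pow]; ring
    | succ a => simp [derivative_pow, map_ofNat]; ring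
  intro w hw
  have := abs_eval_le_of_eulerOp_le hb (g := g) (fun v hv => by
    rw [hF]
    simpa using h v hv) w hw
  simpa using this

lemma abs_eval_le_of_gapPoly_le (a m : ℕ) {K : ℝ} (hK : 0 ≤ K) {g : ℝ[X]}
    (h : ∀ w ∈ Set.Ioo (0 : ℝ) 1, |(aeval eulerOp (gapPoly a (m + 1)) g).eval w| ≤
      K * ((1 - w) ^ a * w ^ (m * (2 * a + 1) + a + 2))) :
    ∀ w ∈ Set.Ioo (0 : ℝ) 1, |g.eval w| ≤
      K / ((m + 1).factorial * (2 * a + 1 : ℝ) ^ (m + 1)) * ((1 - w) ^ a * w ^ (a + 1)) := by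
  induction m generalizing K with
  | zero =>
    have := abs_eval_le_of_gap_factor_le a 0 (K := K) (g := g) (by simpa [gapPoly] using h)
    simpa using this
  | succ m ih =>
    rw [gapPoly, Finset.prod_range_succ, ← gapPoly, aeval_mul_eulerOp'] at h
    have h1 := abs_eval_le_of_gap_factor_le a (m + 1) h
    intro w hw
    have h2 := ih (K := K / (((m + 1 : ℕ) + 1) * (2 * a + 1))) (by positivity)
      (fun v hv => (h1 v hv).trans ?_) w hw
    · refine h2.trans_eq ?_
      rw [Nat.factorial_succ (m + 1), div_div]
      push_cast
      ring
    · have hv1 : 0 ≤ 1 - v := by linarith [hv.2]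
      refine mul_le_mul_of_nonneg_left (mul_le_mul_of_nonneg_left ?_ (by positivity))
        (by positivity)
      -- Removing one gap factor leaves `2a` more powers of `w` than the next step needs; they are
      -- dropped.
      refine pow_le_pow_of_le_one hv.1.le hv.2.le ?_
      linarith

lemma abs_eval_blockPoly_le (a m : ℕ) :
    ∀ w ∈ Set.Ioo (0 : ℝ) 1, |(aeval eulerOp (blockPoly a (m + 1)) X).eval w| ≤
      ((m + 1) * (2 * a + 1)).factorial / ((m + 1).factorial * (2 * a + 1 : ℝ) ^ (m + 1)) *
        ((1 - w) ^ a * w ^ (a + 1)) := by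
  refine abs_eval_le_of_gapPoly_le a m (by positivity) fun w hw => ?_
  have hw0 : 0 < w := hw.1
  have hw1 : 0 < 1 - w := by linarith [hw.2]
  have e : (m + 1) * (2 * a + 1) = a + (m * (2 * a + 1) + a + 1) := by ring
  rw [← aeval_mul_eulerOp', blockPoly_mul_gapPoly, e, ascPochhammer_comp_eulerOp]
  simp only [eval_mul, eval_C, eval_pow, eval_sub, eval_one, eval_X, abs_mul, abs_pow, abs_neg,
    abs_one, one_pow, one_mul, Nat.abs_cast, abs_of_pos hw0, abs_of_pos hw1]
  exact le_refl _

end EulerGamma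

/-! ### Moments, integration by parts and finite differences -/

namespace EulerGamma

open Polynomial

/-- The moment `∫₀¹ x^q p(t / (x + t)) dx`. -/
noncomputable def moment (t : ℝ) (p : ℝ[X]) (q : ℕ) : ℝ :=
  ∫ x in (0 : ℝ)..1, x ^ q * p.eval (t / (x + t))

lemma continuousOn_eval_div {t : ℝ} (ht : 0 < t) (p : ℝ[X]) :
    ContinuousOn (fun x : ℝ => p.eval (t / (x + t))) (Set.Icc 0 1) := by
  refine p.continuous.comp_continuousOn (ContinuousOn.div (by fun_prop) (by fun_prop) ?_)
  intro x hx
  linarith [hx.1]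

lemma intervalIntegrable_mul_eval_div {t : ℝ} (ht : 0 < t) (p : ℝ[X]) {f : ℝ → ℝ}
    (hf : Continuous f) :
    IntervalIntegrable (fun x : ℝ => f x * p.eval (t / (x + t))) MeasureTheory.volume 0 1 := by
  refine ContinuousOn.intervalIntegrable ?_
  rw [Set.uIcc_of_le zero_le_one]
  exact hf.continuousOn.mul (continuousOn_eval_div ht p)

lemma moment_add {t : ℝ} (ht : 0 < t) (p₁ p₂ : ℝ[X]) (q : ℕ) :
    moment t (p₁ + p₂) q = moment t p₁ q + moment t p₂ q := by
  rw [moment, moment, moment, ← intervalIntegral.integral_add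
    (intervalIntegrable_mul_eval_div ht p₁ (by fun_prop))
    (intervalIntegrable_mul_eval_div ht p₂ (by fun_prop))]
  simp [mul_add]

lemma moment_smul (t b : ℝ) (p : ℝ[X]) (q : ℕ) : moment t (b • p) q = b * moment t p q := by
  rw [moment, moment, ← intervalIntegral.integral_const_mul]
  congr 1
  ext x
  simp
  ring

lemma moment_eulerOp {t : ℝ} (ht : 0 < t) (p : ℝ[X]) (q : ℕ) :
    moment t (eulerOp p) q = p.eval (t / (1 + t)) - (q + 1) * moment t p q := by
  have hderiv : ∀ x ∈ Set.uIcc (0 : ℝ) 1, HasDerivAt (fun x : ℝ => x ^ (q + 1) * p.eval (t / (x + t)))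
      ((q + 1) * (x ^ q * p.eval (t / (x + t))) + x ^ q * (eulerOp p).eval (t / (x + t))) x := by
    intro x hx
    rw [Set.uIcc_of_le zero_le_one] at hx
    have hxt : x + t ≠ 0 := by linarith [hx.1]
    have h1 : HasDerivAt (fun x : ℝ => t / (x + t)) (-t / (x + t) ^ 2) x := by
      refine ((hasDerivAt_const x t).div ((hasDerivAt_id x).add_const t) hxt).congr_deriv ?_
      simp
    have h2 := (p.hasDerivAt (t / (x + t))).comp x h1
    refine ((hasDerivAt_pow (q + 1) x).mul h2).congr_deriv ?_
    simp only [eulerOp_apply, eval_mul, eval_sub, eval_pow, eval_X, Function.comp_apply]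
    push_cast
    field_simp
    ring
  have hi1 := (intervalIntegrable_mul_eval_div ht p (f := fun x => x ^ q) (by fun_prop)).const_mul
    ((q : ℝ) + 1)
  have hi2 := intervalIntegrable_mul_eval_div ht (eulerOp p) (f := fun x => x ^ q) (by fun_prop)
  have h := intervalIntegral.integral_eq_sub_of_hasDerivAt hderiv (hi1.add hi2)
  rw [intervalIntegral.integral_add hi1 hi2, intervalIntegral.integral_const_mul] at h
  simp only [one_pow, one_mul, ne_eq, Nat.add_eq_zero_iff, one_ne_zero, and_false,
    not_false_eq_true, zero_pow, zero_mul, sub_zero] at h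
  rw [moment, moment]
  linarith

/-- Integration by parts: polynomial weights in `q` become Euler operators, up to a boundary term
which is a polynomial in `q` of smaller degree. -/
lemma exists_eval_mul_moment {t : ℝ} (ht : 0 < t) (d : ℕ) (Q : ℝ[X]) (hQ : Q.natDegree ≤ d)
    (p : ℝ[X]) : ∃ T : ℝ[X], T.degree < (d : WithBot ℕ) ∧ ∀ q : ℕ,
      Q.eval (-((q : ℝ) + 1)) * moment t p q = T.eval (q : ℝ) + moment t (aeval eulerOp Q p) q := by
  induction d generalizing Q p with
  | zero =>
    refine ⟨0, by simp, fun q => ?_⟩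
    rw [eq_C_of_natDegree_le_zero hQ]
    simp [moment_smul, Module.algebraMap_end_apply]
  | succ d ih =>
    obtain ⟨T, hT, h⟩ := ih Q.divX (by rw [natDegree_divX_eq_natDegree_tsub_one]; omega) (eulerOp p)
    refine ⟨T - C (p.eval (t / (1 + t))) * Q.divX.comp (-(X + C 1)), ?_, fun q => ?_⟩
    · refine lt_of_le_of_lt (degree_sub_le _ _) (max_lt ?_ ?_)
      · exact hT.trans (by exact_mod_cast Nat.lt_succ_self d)
      · refine lt_of_le_of_lt (degree_le_natDegree) ?_
        have h1 : (C (p.eval (t / (1 + t))) * Q.divX.comp (-(X + C 1))).natDegree ≤ d := by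
          refine (natDegree_C_mul_le _ _).trans (natDegree_comp_le.trans ?_)
          rw [natDegree_neg, natDegree_X_add_C, natDegree_divX_eq_natDegree_tsub_one]
          omega
        exact_mod_cast Nat.lt_succ_of_le h1
    · have hq := h q
      have hA : aeval eulerOp Q p = aeval eulerOp Q.divX (eulerOp p) + Q.coeff 0 • p := by
        conv_lhs => rw [← divX_mul_X_add Q]
        simp [Module.algebraMap_end_apply]
      have hE : Q.eval (-((q : ℝ) + 1)) =
          Q.divX.eval (-((q : ℝ) + 1)) * (-((q : ℝ) + 1)) + Q.coeff 0 := by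
        conv_lhs => rw [← divX_mul_X_add Q]
        simp
      rw [moment_eulerOp ht] at hq
      rw [hA, moment_add ht, moment_smul, hE]
      simp only [eval_sub, eval_mul, eval_C, eval_comp, eval_neg, eval_add, eval_X]
      linear_combination hq

lemma alternating_sum_eval_nat (N : ℕ) (P : ℝ[X]) :
    ∑ k ∈ Finset.range (N + 1), (-1 : ℝ) ^ k * (N.choose k : ℝ) * P.eval (k : ℝ) =
      (-1) ^ N * (fwdDiff 1)^[N] P.eval 0 := by
  rw [fwdDiff_iter_eq_sum_shift, Finset.mul_sum]
  refine Finset.sum_congr rfl fun k hk => ?_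
  have hk : k ≤ N := Nat.lt_succ_iff.1 (Finset.mem_range.1 hk)
  have h : (-1 : ℝ) ^ N * (-1) ^ (N - k) = (-1) ^ k := by
    obtain ⟨j, rfl⟩ := Nat.exists_eq_add_of_le hk
    rw [Nat.add_sub_cancel_left, pow_add, mul_assoc, ← mul_pow]
    simp
  rw [← h]
  simp
  ring

lemma alternating_sum_eval_arith_eq_zero {N : ℕ} (r K : ℕ) {T : ℝ[X]}
    (hT : T.degree < (N : WithBot ℕ)) :
    ∑ k ∈ Finset.range (N + 1), (-1 : ℝ) ^ k * (N.choose k : ℝ) * T.eval ((r * k + K : ℕ) : ℝ) =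
      0 := by
  rcases eq_or_ne T 0 with rfl | h0
  · simp
  have hT' : T.natDegree < N := (natDegree_lt_iff_degree_lt h0).2 hT
  have h := alternating_sum_eval_nat N (T.comp (C (r : ℝ) * X + C (K : ℝ)))
  rw [fwdDiff_iter_eq_zero_of_degree_lt, Pi.zero_apply, mul_zero] at h
  · rw [← h]
    simp
  · refine lt_of_le_of_lt (natDegree_comp_le.trans ?_) hT'
    exact (Nat.mul_le_mul_left _ natDegree_linear_le).trans_eq (mul_one _)

/-- An `N`-th difference sees only the leading coefficient, here `(-r)^N = r^N` because `N` is even.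
-/
lemma alternating_sum_eval_neg_arith {N : ℕ} (hN : Even N) {r : ℕ} (hr : 0 < r) (K : ℕ) {Q : ℝ[X]}
    (hQ : Q.Monic) (hd : Q.natDegree = N) :
    ∑ k ∈ Finset.range (N + 1), (-1 : ℝ) ^ k * (N.choose k : ℝ) *
      Q.eval (-(((r * k + K : ℕ) : ℝ) + 1)) = N.factorial * (r : ℝ) ^ N := by
  have hr' : (-(r : ℝ)) ≠ 0 := by simpa using hr.ne'
  have h := alternating_sum_eval_nat N (Q.comp (C (-(r : ℝ)) * X + C (-((K : ℝ) + 1))))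
  have hdeg : (Q.comp (C (-(r : ℝ)) * X + C (-((K : ℝ) + 1)))).natDegree = N := by
    rw [natDegree_comp, natDegree_linear hr', hd, mul_one]
  have hlc : (Q.comp (C (-(r : ℝ)) * X + C (-((K : ℝ) + 1)))).leadingCoeff = (r : ℝ) ^ N := by
    rw [leadingCoeff_comp (by rw [natDegree_linear hr']; exact one_ne_zero), hQ.leadingCoeff,
      leadingCoeff_linear hr', hd, one_mul, hN.neg_pow]
  have hf := fwdDiff_iter_degree_eq_factorial (Q.comp (C (-(r : ℝ)) * X + C (-((K : ℝ) + 1))))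
  rw [hdeg, hlc] at hf
  rw [hf, hN.neg_one_pow, one_mul] at h
  have e : ((r : ℝ) ^ N • (N.factorial : ℝ → ℝ)) 0 = N.factorial * (r : ℝ) ^ N := by
    simp [mul_comm]
  rw [e] at h
  rw [← h]
  refine Finset.sum_congr rfl fun k _ => ?_
  congr 1
  rw [eval_comp]
  congr 1
  simp
  ring

lemma alternating_sum_eval_mul_moment {t : ℝ} (ht : 0 < t) {N : ℕ} (r K : ℕ) {Q : ℝ[X]}
    (hd : Q.natDegree ≤ N) (p : ℝ[X]) :
    ∑ k ∈ Finset.range (N + 1), (-1 : ℝ) ^ k * (N.choose k : ℝ) *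
      (Q.eval (-(((r * k + K : ℕ) : ℝ) + 1)) * moment t p (r * k + K)) =
      ∫ x in (0 : ℝ)..1, x ^ K * (1 - x ^ r) ^ N * (aeval eulerOp Q p).eval (t / (x + t)) := by
  obtain ⟨T, hT, h⟩ := exists_eval_mul_moment ht N Q hd p
  simp_rw [h, mul_add]
  rw [Finset.sum_add_distrib, alternating_sum_eval_arith_eq_zero r K hT, zero_add]
  simp_rw [moment, ← intervalIntegral.integral_const_mul]
  rw [← intervalIntegral.integral_finsetSum]
  · congr 1
    ext x
    have hb : (1 - x ^ r) ^ N = ∑ k ∈ Finset.range (N + 1), (-1 : ℝ) ^ k * (N.choose k : ℝ) *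
        x ^ (r * k) := by
      rw [sub_eq_neg_add, add_pow]
      refine Finset.sum_congr rfl fun k _ => ?_
      rw [neg_pow, ← pow_mul]
      simp
      ring
    rw [hb, Finset.mul_sum, Finset.sum_mul]
    refine Finset.sum_congr rfl fun k _ => ?_
    ring
  · exact fun k _ => (intervalIntegrable_mul_eval_div ht _ (by fun_prop)).const_mul _

lemma abs_alternating_sum_moment_le {t : ℝ} (ht : 0 < t) (a m r : ℕ) {ρ : ℝ}
    (hρ : ∀ x ∈ Set.Icc (0 : ℝ) 1, x * (1 - x ^ r) ≤ ρ) :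
    |∑ k ∈ Finset.range ((m + 1) * (2 * a) + 1),
        (-1 : ℝ) ^ k * (((m + 1) * (2 * a)).choose k : ℝ) *
        ((blockPoly a (m + 1)).eval
          (-(((r * k + ((m + 1) * (2 * a) + (m + 1)) : ℕ) : ℝ) + 1)) *
          moment t X (r * k + ((m + 1) * (2 * a) + (m + 1))))| ≤
      ((m + 1) * (2 * a + 1)).factorial / ((m + 1).factorial * (2 * a + 1 : ℝ) ^ (m + 1)) *
        (1 / 4) ^ a * ρ ^ ((m + 1) * (2 * a)) * moment t X (m + 1) := by
  rw [alternating_sum_eval_mul_moment ht r _ (natDegree_blockPoly a (m + 1)).le, moment,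
    ← intervalIntegral.integral_const_mul]
  set D : ℝ := ((m + 1) * (2 * a + 1)).factorial /
    ((m + 1).factorial * (2 * a + 1 : ℝ) ^ (m + 1)) with hD
  have hD0 : 0 ≤ D := by positivity
  rw [← Real.norm_eq_abs]
  refine intervalIntegral.norm_integral_le_of_norm_le zero_le_one ?_
    ((intervalIntegrable_mul_eval_div ht X (by fun_prop)).const_mul _)
  refine Filter.Eventually.of_forall fun x hx => ?_
  have hx0 : 0 < x := hx.1
  have hx1 : 0 ≤ 1 - x ^ r := sub_nonneg.2 (pow_le_one₀ hx0.le hx.2)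
  have hw0 : 0 < t / (x + t) := by positivity
  have hw1 : t / (x + t) < 1 := by rw [div_lt_one (by positivity)]; linarith
  have hh := abs_eval_blockPoly_le a m (t / (x + t)) ⟨hw0, hw1⟩
  rw [← hD] at hh
  generalize t / (x + t) = w at *
  have hw : ((1 - w) * w) ^ a ≤ (1 / 4) ^ a :=
    pow_le_pow_left₀ (mul_nonneg (by linarith) hw0.le) (by nlinarith [sq_nonneg (w - 1 / 2)]) a
  have hxr : (x * (1 - x ^ r)) ^ ((m + 1) * (2 * a)) ≤ ρ ^ ((m + 1) * (2 * a)) :=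
    pow_le_pow_left₀ (mul_nonneg hx0.le hx1) (hρ x ⟨hx0.le, hx.2⟩) _
  rw [Real.norm_eq_abs, abs_mul, abs_of_nonneg (by positivity)]
  calc x ^ ((m + 1) * (2 * a) + (m + 1)) * (1 - x ^ r) ^ ((m + 1) * (2 * a)) *
        |(aeval eulerOp (blockPoly a (m + 1)) X).eval w|
      ≤ x ^ ((m + 1) * (2 * a) + (m + 1)) * (1 - x ^ r) ^ ((m + 1) * (2 * a)) *
        (D * ((1 - w) ^ a * w ^ (a + 1))) := by gcongr
    -- The shift `N + (m+1)` pairs `x^N` with `(1 - x^r)^N` and leaves `x^(m+1) w`, the integrand of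
    -- a moment.
    _ = D * ((1 - w) * w) ^ a * (x * (1 - x ^ r)) ^ ((m + 1) * (2 * a)) * (x ^ (m + 1) * w) := by
      rw [mul_pow, mul_pow]; ring
    _ ≤ D * (1 / 4) ^ a * ρ ^ ((m + 1) * (2 * a)) * (x ^ (m + 1) * w) := by gcongr
    _ = _ := by simp

end EulerGamma

/-! ### Integral representation of `γ - S_q` by a positive mixture of moments -/

namespace EulerGamma

open Polynomial MeasureTheory Set

/-- The kernel `(1 - x ^ s) / (1 - x)`. -/
noncomputable def rpowKernel (s x : ℝ) : ℝ := (1 - x ^ s) / (1 - x)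

/-- The Stieltjes density representing `rpowKernel s`. -/
noncomputable def stieltjesDensity (s t : ℝ) : ℝ :=
  (∫ t in Ioi (0 : ℝ), Real.rpowIntegrand₀₁ s t 1)⁻¹ * (t ^ (s - 1) / (1 + t))

lemma stieltjesDensity_nonneg {s t : ℝ} (hs : s ∈ Ioo (0 : ℝ) 1) (ht : 0 < t) :
    0 ≤ stieltjesDensity s t := by
  have := Real.integral_rpowIntegrand₀₁_one_pos hs
  rw [stieltjesDensity]
  positivity

lemma stieltjesDensity_mul_div {s t x : ℝ} (hx : x ∈ Ioo (0 : ℝ) 1)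
    (ht : 0 < t) :
    stieltjesDensity s t * (t / (x + t)) =
      (∫ t in Ioi (0 : ℝ), Real.rpowIntegrand₀₁ s t 1)⁻¹ *
        ((Real.rpowIntegrand₀₁ s t 1 - Real.rpowIntegrand₀₁ s t x) / (1 - x)) := by
  have hx0 : 0 < x := hx.1
  have hx1 : 1 - x ≠ 0 := by linarith [hx.2]
  have e : t ^ s = t ^ (s - 1) * t := by rw [← Real.rpow_add_one ht.ne']; ring_nf
  rw [stieltjesDensity, Real.rpowIntegrand₀₁, Real.rpowIntegrand₀₁, e]
  field_simp
  ring

lemma integrableOn_stieltjesDensity_mul_div {s x : ℝ} (hs : s ∈ Ioo (0 : ℝ) 1)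
    (hx : x ∈ Ioo (0 : ℝ) 1) :
    IntegrableOn (fun t => stieltjesDensity s t * (t / (x + t))) (Ioi 0) := by
  refine IntegrableOn.congr_fun ?_ (fun t ht => (stieltjesDensity_mul_div hx ht).symm)
    measurableSet_Ioi
  exact (((Real.integrableOn_rpowIntegrand₀₁_Ioi hs zero_le_one).sub
    (Real.integrableOn_rpowIntegrand₀₁_Ioi hs hx.1.le)).div_const _).const_mul _

/-- Subtract the integral representations of `1^s` and `x^s`, then divide by `1 - x`. -/
lemma integral_stieltjesDensity_mul_div {s x : ℝ} (hs : s ∈ Ioo (0 : ℝ) 1)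
    (hx : x ∈ Ioo (0 : ℝ) 1) :
    ∫ t in Ioi (0 : ℝ), stieltjesDensity s t * (t / (x + t)) = rpowKernel s x := by
  rw [setIntegral_congr_fun measurableSet_Ioi (fun t ht => stieltjesDensity_mul_div hx ht),
    integral_const_mul, integral_div, integral_sub
      (Real.integrableOn_rpowIntegrand₀₁_Ioi hs zero_le_one)
      (Real.integrableOn_rpowIntegrand₀₁_Ioi hs hx.1.le), rpowKernel, ← mul_div_assoc, mul_sub,
    ← Real.rpow_eq_const_mul_integral hs zero_le_one,
    ← Real.rpow_eq_const_mul_integral hs hx.1.le, Real.one_rpow]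

lemma rpowKernel_mem_Icc {s x : ℝ} (hs : s ∈ Icc (0 : ℝ) 1) (hx : x ∈ Ioo (0 : ℝ) 1) :
    rpowKernel s x ∈ Icc (0 : ℝ) 1 := by
  have hx1 : 0 < 1 - x := by linarith [hx.2]
  have h1 : x ^ s ≤ 1 := Real.rpow_le_one hx.1.le hx.2.le hs.1
  have h2 : x ≤ x ^ s := by
    simpa using Real.rpow_le_rpow_of_exponent_ge hx.1 hx.2.le hs.2
  exact ⟨div_nonneg (by linarith) hx1.le, (div_le_one hx1).2 (by linarith)⟩

lemma measurable_rpowKernel (s : ℝ) : Measurable (rpowKernel s) := by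
  unfold rpowKernel
  fun_prop

lemma integrableOn_pow_mul_rpowKernel {s : ℝ} (hs : s ∈ Icc (0 : ℝ) 1) (q : ℕ) :
    IntegrableOn (fun x => x ^ q * rpowKernel s x) (Ioo 0 1) := by
  refine Measure.integrableOn_of_bounded (M := 1) (by simp)
    (((measurable_id.pow_const q).mul (measurable_rpowKernel s)).aestronglyMeasurable) ?_
  refine (ae_restrict_iff' measurableSet_Ioo).2 (Filter.Eventually.of_forall fun x hx => ?_)
  have h := rpowKernel_mem_Icc hs hx
  rw [Real.norm_eq_abs, abs_of_nonneg (mul_nonneg (pow_nonneg hx.1.le q) h.1)]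
  exact mul_le_one₀ (pow_le_one₀ hx.1.le hx.2.le) h.1 h.2

/-- The moments of `rpowKernel s` on `(0, 1)`. -/
noncomputable def kernelMoment (s : ℝ) (q : ℕ) : ℝ :=
  ∫ x in Ioo (0 : ℝ) 1, x ^ q * rpowKernel s x

lemma moment_X (t : ℝ) (q : ℕ) :
    moment t X q = ∫ x in Ioo (0 : ℝ) 1, x ^ q * (t / (x + t)) := by
  rw [moment, intervalIntegral.integral_of_le zero_le_one, integral_Ioc_eq_integral_Ioo]
  simp

lemma integrable_stieltjesDensity_prod {s : ℝ} (hs : s ∈ Ioo (0 : ℝ) 1) (q : ℕ) :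
    Integrable (Function.uncurry fun t x : ℝ => x ^ q * (stieltjesDensity s t * (t / (x + t))))
      ((volume.restrict (Ioi 0)).prod (volume.restrict (Ioo 0 1))) := by
  have hmeas : Measurable
      (Function.uncurry fun t x : ℝ => x ^ q * (stieltjesDensity s t * (t / (x + t)))) := by
    unfold stieltjesDensity Function.uncurry
    fun_prop
  refine (integrable_prod_iff' hmeas.aestronglyMeasurable).2 ⟨?_, ?_⟩
  · refine (ae_restrict_iff' measurableSet_Ioo).2 (Filter.Eventually.of_forall fun x hx => ?_)
    exact (integrableOn_stieltjesDensity_mul_div hs hx).const_mul (x ^ q)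
  · refine IntegrableOn.congr_fun (integrableOn_pow_mul_rpowKernel (Ioo_subset_Icc_self hs) q)
      (fun x hx => ?_) measurableSet_Ioo
    have hx0 : 0 < x := hx.1
    simp only [Function.uncurry]
    rw [← integral_stieltjesDensity_mul_div hs hx, ← integral_const_mul]
    refine setIntegral_congr_fun measurableSet_Ioi fun t ht => ?_
    have ht0 : (0 : ℝ) < t := ht
    have := stieltjesDensity_nonneg hs ht0
    exact (Real.norm_of_nonneg (by positivity)).symm

lemma integral_stieltjesDensity_moment_aux (s : ℝ) (q : ℕ) (t : ℝ) :
    ∫ x in Ioo (0 : ℝ) 1, x ^ q * (stieltjesDensity s t * (t / (x + t))) =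
      stieltjesDensity s t * moment t X q := by
  rw [moment_X, ← integral_const_mul]
  congr 1
  ext x
  ring

lemma integrableOn_stieltjesDensity_mul_moment {s : ℝ} (hs : s ∈ Ioo (0 : ℝ) 1) (q : ℕ) :
    IntegrableOn (fun t => stieltjesDensity s t * moment t X q) (Ioi 0) := by
  have h := (integrable_stieltjesDensity_prod hs q).integral_prod_left
  simpa only [Function.uncurry, integral_stieltjesDensity_moment_aux, IntegrableOn] using h

lemma kernelMoment_eq_integral {s : ℝ} (hs : s ∈ Ioo (0 : ℝ) 1) (q : ℕ) :
    kernelMoment s q = ∫ t in Ioi (0 : ℝ), stieltjesDensity s t * moment t X q := by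
  have h := integral_integral_swap (integrable_stieltjesDensity_prod hs q)
  simp only [integral_stieltjesDensity_moment_aux] at h
  rw [h, kernelMoment]
  refine setIntegral_congr_fun measurableSet_Ioo fun x hx => ?_
  rw [integral_const_mul, integral_stieltjesDensity_mul_div hs hx]

/-- Supplies integrability in `s` without a continuity argument. -/
lemma monotoneOn_kernelMoment (q : ℕ) : MonotoneOn (fun s => kernelMoment s q) (Icc 0 1) := by
  intro s hs s' hs' hss
  refine setIntegral_mono_on (integrableOn_pow_mul_rpowKernel hs q)
    (integrableOn_pow_mul_rpowKernel hs' q) measurableSet_Ioo fun x hx => ?_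
  have hx1 : 0 < 1 - x := by linarith [hx.2]
  have := Real.rpow_le_rpow_of_exponent_ge hx.1 hx.2.le hss
  have hx0 := hx.1.le
  unfold rpowKernel
  gcongr

lemma intervalIntegrable_kernelMoment (q : ℕ) :
    IntervalIntegrable (fun s => kernelMoment s q) volume 0 1 :=
  MonotoneOn.intervalIntegrable (by
    rw [uIcc_of_le zero_le_one]
    exact monotoneOn_kernelMoment q)

lemma integral_pow_Ioo (q : ℕ) : ∫ x in Ioo (0 : ℝ) 1, x ^ q = 1 / ((q : ℝ) + 1) := by
  rw [← integral_Ioc_eq_integral_Ioo, ← intervalIntegral.integral_of_le zero_le_one, integral_pow]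
  simp

lemma kernelMoment_sub_succ {s : ℝ} (hs : s ∈ Icc (0 : ℝ) 1) (q : ℕ) :
    kernelMoment s q - kernelMoment s (q + 1) = 1 / ((q : ℝ) + 1) - 1 / (s + ((q : ℝ) + 1)) := by
  have h2 : ∫ x in Ioo (0 : ℝ) 1, x ^ ((q : ℝ) + s) = 1 / (s + ((q : ℝ) + 1)) := by
    have hq : (0 : ℝ) ≤ q := q.cast_nonneg
    rw [← integral_Ioc_eq_integral_Ioo, ← intervalIntegral.integral_of_le zero_le_one,
      integral_rpow (Or.inl (by linarith [hs.1])), Real.one_rpow, Real.zero_rpow, sub_zero]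
    · ring
    · linarith [hs.1]
  have hi1 : IntegrableOn (fun x : ℝ => x ^ q) (Ioo 0 1) :=
    ((continuous_pow q).integrableOn_Icc (a := 0) (b := 1)).mono_set Ioo_subset_Icc_self
  have hi2 : IntegrableOn (fun x : ℝ => x ^ ((q : ℝ) + s)) (Ioo 0 1) := by
    have hq : (0 : ℝ) ≤ q := q.cast_nonneg
    refine ((Real.continuous_rpow_const (q := (q : ℝ) + s) (by linarith [hs.1])).integrableOn_Icc
      (a := 0) (b := 1)).mono_set Ioo_subset_Icc_self
  rw [kernelMoment, kernelMoment, ← integral_sub (integrableOn_pow_mul_rpowKernel hs q)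
    (integrableOn_pow_mul_rpowKernel hs (q + 1)), ← integral_pow_Ioo, ← h2, ← integral_sub hi1 hi2]
  refine setIntegral_congr_fun measurableSet_Ioo fun x hx => ?_
  have hx1 : 1 - x ≠ 0 := by linarith [hx.2]
  simp only [rpowKernel]
  rw [Real.rpow_add hx.1, Real.rpow_natCast]
  field_simp
  ring

lemma kernelMoment_nonneg {s : ℝ} (hs : s ∈ Icc (0 : ℝ) 1) (q : ℕ) : 0 ≤ kernelMoment s q :=
  setIntegral_nonneg measurableSet_Ioo fun _ hx =>
    mul_nonneg (pow_nonneg hx.1.le q) (rpowKernel_mem_Icc hs hx).1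

lemma kernelMoment_le {s : ℝ} (hs : s ∈ Icc (0 : ℝ) 1) (q : ℕ) :
    kernelMoment s q ≤ 1 / ((q : ℝ) + 1) := by
  rw [← integral_pow_Ioo]
  refine setIntegral_mono_on (integrableOn_pow_mul_rpowKernel hs q)
    (((continuous_pow q).integrableOn_Icc (a := 0) (b := 1)).mono_set Ioo_subset_Icc_self)
    measurableSet_Ioo fun x hx => ?_
  exact mul_le_of_le_one_right (pow_nonneg hx.1.le q) (rpowKernel_mem_Icc hs hx).2

lemma integral_kernelMoment_sub_succ (q : ℕ) :
    (∫ s in (0 : ℝ)..1, kernelMoment s q) - ∫ s in (0 : ℝ)..1, kernelMoment s (q + 1) =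
      Real.eulerMascheroniSeq (q + 1) - Real.eulerMascheroniSeq q := by
  have hq : (0 : ℝ) < (q : ℝ) + 1 := by positivity
  rw [← intervalIntegral.integral_sub (intervalIntegrable_kernelMoment q)
    (intervalIntegrable_kernelMoment (q + 1)), intervalIntegral.integral_congr (g := fun s =>
      1 / ((q : ℝ) + 1) - 1 / (s + ((q : ℝ) + 1))) (fun s hs => by
        rw [uIcc_of_le zero_le_one] at hs
        exact kernelMoment_sub_succ hs q), intervalIntegral.integral_sub]
  · rw [intervalIntegral.integral_comp_add_right (fun s : ℝ => 1 / s),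
      integral_one_div_of_pos (by linarith) (by linarith), Real.log_div (by linarith) (by linarith)]
    simp only [Real.eulerMascheroniSeq, harmonic_succ, intervalIntegral.integral_const]
    push_cast
    simp
    ring_nf
  · exact intervalIntegrable_const
  · refine ContinuousOn.intervalIntegrable ?_
    rw [uIcc_of_le zero_le_one]
    refine ContinuousOn.div (by fun_prop) (by fun_prop) fun s hs => ?_
    linarith [hs.1]

/-- Both sides have the same differences in `q`, and both tend to `0`. -/
lemma eulerMascheroniConstant_sub_eq_integral (q : ℕ) :
    Real.eulerMascheroniConstant - Real.eulerMascheroniSeq q =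
      ∫ s in (0 : ℝ)..1, kernelMoment s q := by
  have hconst : ∀ n : ℕ, (∫ s in (0 : ℝ)..1, kernelMoment s (q + n)) +
      Real.eulerMascheroniSeq (q + n) =
      (∫ s in (0 : ℝ)..1, kernelMoment s q) + Real.eulerMascheroniSeq q := by
    intro n
    induction n with
    | zero => rfl
    | succ n ih =>
      have := integral_kernelMoment_sub_succ (q + n)
      rw [← add_assoc]
      linarith
  have h0 : Filter.Tendsto (fun n : ℕ => ∫ s in (0 : ℝ)..1, kernelMoment s n) Filter.atTop
      (nhds 0) := by
    refine squeeze_zero (fun n => ?_) (fun n => ?_) tendsto_one_div_add_atTop_nhds_zero_nat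
    · exact intervalIntegral.integral_nonneg zero_le_one fun s hs => kernelMoment_nonneg hs n
    · have := intervalIntegral.integral_mono_on zero_le_one (intervalIntegrable_kernelMoment n)
        (intervalIntegrable_const (c := 1 / ((n : ℝ) + 1))) fun s hs => kernelMoment_le hs n
      simpa using this
  have hshift : Filter.Tendsto (fun n : ℕ => q + n) Filter.atTop Filter.atTop :=
    Filter.tendsto_atTop_mono (fun n => Nat.le_add_left n q) Filter.tendsto_id
  have h1 := (h0.add Real.tendsto_eulerMascheroniSeq).comp hshift
  have h2 := tendsto_nhds_unique h1
    ((tendsto_const_nhds (α := ℕ)).congr fun n => (hconst n).symm)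
  linarith

/-- An inequality between linear combinations of the functions `t ↦ moment t X q` carries over to
the numbers `γ - S_q`, since these are the averages of those functions over a positive measure. -/
lemma abs_sum_mul_eulerMascheroniConstant_sub_le {ι : Type*} (S : Finset ι) (c : ι → ℝ) (q : ι → ℕ)
    (B : ℝ) (m : ℕ)
    (h : ∀ t : ℝ, 0 < t → |∑ k ∈ S, c k * moment t X (q k)| ≤ B * moment t X m) :
    |∑ k ∈ S, c k * (Real.eulerMascheroniConstant - Real.eulerMascheroniSeq (q k))| ≤
      B * (Real.eulerMascheroniConstant - Real.eulerMascheroniSeq m) := by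
  have hs : ∀ s ∈ Ioo (0 : ℝ) 1, |∑ k ∈ S, c k * kernelMoment s (q k)| ≤ B * kernelMoment s m := by
    intro s hs
    simp_rw [kernelMoment_eq_integral hs, ← integral_const_mul]
    rw [← integral_finsetSum S fun k _ =>
      (integrableOn_stieltjesDensity_mul_moment hs (q k)).const_mul (c k), ← Real.norm_eq_abs]
    refine norm_integral_le_of_norm_le ((integrableOn_stieltjesDensity_mul_moment hs m).const_mul B)
      ((ae_restrict_iff' measurableSet_Ioi).2 (Filter.Eventually.of_forall fun t ht => ?_))
    have h1 : ∑ k ∈ S, c k * (stieltjesDensity s t * moment t X (q k)) =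
        stieltjesDensity s t * ∑ k ∈ S, c k * moment t X (q k) := by
      rw [Finset.mul_sum]
      exact Finset.sum_congr rfl fun k _ => by ring
    rw [h1, Real.norm_eq_abs, abs_mul, abs_of_nonneg (stieltjesDensity_nonneg hs ht)]
    calc _ ≤ stieltjesDensity s t * (B * moment t X m) :=
          mul_le_mul_of_nonneg_left (h t ht) (stieltjesDensity_nonneg hs ht)
      _ = _ := by ring
  simp_rw [eulerMascheroniConstant_sub_eq_integral, ← intervalIntegral.integral_const_mul]
  rw [← intervalIntegral.integral_finsetSum fun k _ =>
      (intervalIntegrable_kernelMoment (q k)).const_mul (c k), ← Real.norm_eq_abs]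
  refine intervalIntegral.norm_integral_le_of_norm_le zero_le_one ?_
    ((intervalIntegrable_kernelMoment m).const_mul B)
  -- The Stieltjes representation needs `s < 1`, while the interval integral runs over `(0, 1]`.
  have h1 : ∀ᵐ s : ℝ, s ≠ 1 := by simp [ae_iff]
  filter_upwards [h1] with s hs1 hs0
  exact hs s ⟨hs0.1, lt_of_le_of_ne hs0.2 hs1⟩

end EulerGamma

/-! ### Explicit constants and conclusion -/

namespace EulerGamma

open Polynomial

lemma eval_blockPoly_neg (a m z : ℕ) :
    (blockPoly a m).eval (-(((z + (m * (2 * a) + m) : ℕ) : ℝ) + 1)) =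
      ((2 * a).factorial : ℝ) ^ m *
        ∏ j ∈ Finset.Icc 1 m, ((z + (2 * j + 1) * a + j).choose (2 * a) : ℝ) := by
  have hIcc : ∏ j ∈ Finset.Icc 1 m, ((z + (2 * j + 1) * a + j).choose (2 * a) : ℝ) =
      ∏ l ∈ Finset.range m, ((z + (2 * (m - l) + 1) * a + (m - l)).choose (2 * a) : ℝ) := by
    -- Block `l` of `blockPoly` gives the binomial with index `j = m - l`, so the order is reversed.
    rw [← Finset.Ico_add_one_right_eq_Icc, Finset.prod_Ico_eq_prod_range, Nat.add_sub_cancel,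
      ← Finset.prod_range_reflect]
    refine Finset.prod_congr rfl fun l hl => ?_
    have := Finset.mem_range.1 hl
    rw [show 1 + (m - 1 - l) = m - l by omega]
  rw [hIcc, blockPoly, eval_prod, ← Finset.card_range m, ← Finset.prod_const, Finset.card_range,
    ← Finset.prod_mul_distrib]
  refine Finset.prod_congr rfl fun l hl => ?_
  obtain ⟨i, rfl⟩ := Nat.exists_eq_add_of_lt (Finset.mem_range.1 hl)
  have hsub : l + i + 1 - l = i + 1 := by omega
  rw [hsub, ← Nat.cast_mul, ← Nat.descFactorial_eq_factorial_mul_choose,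
    ← descPochhammer_eval_eq_descFactorial, eval_comp]
  have h := ascPochhammer_eval_neg_eq_descPochhammer ℝ
    ((z + (2 * (i + 1) + 1) * a + (i + 1) : ℕ) : ℝ) (2 * a)
  -- Each block has `2a` factors, so negating all of them costs no sign.
  rw [(even_two_mul a).neg_one_pow, one_mul] at h
  rw [← h]
  congr 1
  simp
  ring

lemma mul_one_sub_pow_le {r : ℕ} (hr : 0 < r) {x : ℝ} (hx : x ∈ Set.Icc (0 : ℝ) 1) :
    x * (1 - x ^ r) ≤ r / ((r : ℝ) + 1) ^ (1 + 1 / (r : ℝ)) := by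
  have hr0 : (0 : ℝ) < r := by exact_mod_cast hr
  have hx0 := hx.1
  have hx1 : 0 ≤ 1 - x ^ r := sub_nonneg.2 (pow_le_one₀ hx0 hx.2)
  have hp1 : 0 ≤ x ^ r * (r + 1) := by positivity
  have hp2 : 0 ≤ (1 - x ^ r) * ((r + 1) / r) := by positivity
  -- Weighted AM-GM, with the two terms scaled so that the arithmetic mean is exactly `1`; raising
  -- to the power `(r+1)/r` isolates `x(1 - x^r)`.
  have h := Real.geom_mean_le_arith_mean2_weighted (w₁ := 1 / ((r : ℝ) + 1))
    (w₂ := r / ((r : ℝ) + 1)) (by positivity) (by positivity) hp1 hp2 (by field_simp; ring)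
  have e : 1 / ((r : ℝ) + 1) * (x ^ r * (r + 1)) +
      r / ((r : ℝ) + 1) * ((1 - x ^ r) * ((r + 1) / r)) = 1 := by
    field_simp
    ring
  rw [e] at h
  have h2 := Real.rpow_le_one (by positivity) h (z := ((r : ℝ) + 1) / r) (by positivity)
  rw [Real.mul_rpow (by positivity) (by positivity), ← Real.rpow_mul hp1, ← Real.rpow_mul hp2,
    show 1 / ((r : ℝ) + 1) * ((r + 1) / r) = 1 / r by field_simp,
    show r / ((r : ℝ) + 1) * ((r + 1) / r) = 1 by field_simp, Real.rpow_one,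
    Real.mul_rpow (by positivity) (by positivity), ← Real.rpow_natCast, ← Real.rpow_mul hx0,
    mul_one_div_cancel hr0.ne', Real.rpow_one, Real.rpow_natCast] at h2
  rw [le_div_iff₀ (by positivity), Real.rpow_add (by positivity), Real.rpow_one]
  calc x * (1 - x ^ r) * (((r : ℝ) + 1) * ((r : ℝ) + 1) ^ (1 / (r : ℝ)))
      = (x * ((r : ℝ) + 1) ^ (1 / (r : ℝ)) * ((1 - x ^ r) * ((r + 1) / r))) * r := by field_simp
    _ ≤ 1 * r := by gcongr
    _ = r := one_mul _

lemma factorial_ratio_le (a m : ℕ) :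
    (((m + 1) * (2 * a + 1)).factorial : ℝ) /
      ((m + 1).factorial * (2 * a + 1 : ℝ) ^ (m + 1)) / ((m + 1) * (2 * a)).factorial ≤
      ((m + 1 : ℕ) : ℝ) ^ (m + 1) / m.factorial := by
  have h1 : ((m + 1) * (2 * a + 1)).factorial ≤
      ((m + 1) * (2 * a)).factorial * ((m + 1) * (2 * a + 1)) ^ (m + 1) := by
    have e : (m + 1) * (2 * a + 1) = (m + 1) * (2 * a) + (m + 1) := by ring
    rw [e, ← Nat.factorial_mul_ascFactorial]
    exact Nat.mul_le_mul_left _ (Nat.ascFactorial_le_pow_add _ _)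
  have h2 : (((m + 1) * (2 * a + 1)).factorial : ℝ) ≤
      ((m + 1) * (2 * a)).factorial * (((m + 1 : ℕ) : ℝ) ^ (m + 1) * (2 * a + 1 : ℝ) ^ (m + 1)) := by
    rw [← mul_pow]
    exact_mod_cast h1
  have h3 : (m.factorial : ℝ) ≤ (m + 1).factorial := by
    exact_mod_cast Nat.factorial_le (Nat.le_succ m)
  calc _ ≤ (((m + 1) * (2 * a)).factorial *
          (((m + 1 : ℕ) : ℝ) ^ (m + 1) * (2 * a + 1 : ℝ) ^ (m + 1))) /
        ((m + 1).factorial * (2 * a + 1 : ℝ) ^ (m + 1)) / ((m + 1) * (2 * a)).factorial := by gcongr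
    _ = ((m + 1 : ℕ) : ℝ) ^ (m + 1) / (m + 1).factorial := by
      have := Nat.factorial_ne_zero ((m + 1) * (2 * a))
      have := Nat.factorial_ne_zero (m + 1)
      field_simp
    _ ≤ _ := by gcongr

lemma rate_pow_eq (c m r n : ℕ) :
    (1 / 4 : ℝ) ^ (c * n) *
        ((r : ℝ) / ((r : ℝ) + 1) ^ (1 + 1 / (r : ℝ))) ^ (m * (2 * (c * n))) =
      (1 / ((4 : ℝ) ^ c * ((r : ℝ) + 1) ^ ((2 * m * c : ℝ) + (2 * m * c : ℝ) / (r : ℝ)))) ^ n *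
        (r : ℝ) ^ (m * (2 * (c * n))) := by
  have h : ((r : ℝ) + 1) ^ ((2 * m * c : ℝ) + (2 * m * c : ℝ) / (r : ℝ)) =
      (((r : ℝ) + 1) ^ (1 + 1 / (r : ℝ))) ^ (m * (2 * c)) := by
    rw [← Real.rpow_natCast, ← Real.rpow_mul (by positivity)]
    congr 1
    push_cast
    ring
  have e : m * (2 * (c * n)) = m * (2 * c) * n := by ring
  rw [h, e, div_pow, div_pow, div_pow, mul_pow, one_pow, one_pow, ← pow_mul, ← pow_mul]
  field_simp

end EulerGamma

open EulerGamma in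
theorem corollary4 (c m r n : ℕ) (hc : 0 < c) (hm : 0 < m) (hr : 0 < r) (hn : 0 < n) :
    |Real.eulerMascheroniConstant -
        (((2 * c * n).factorial : ℝ) ^ m /
            (((2 * m * c * n).factorial : ℝ) * (r : ℝ) ^ (2 * m * c * n))) *
          ∑ k ∈ Finset.range (2 * m * c * n + 1),
            (-1 : ℝ) ^ k * ((2 * m * c * n).choose k : ℝ) *
              (∏ j ∈ Finset.Icc 1 m,
                ((r * k + (2 * j + 1) * c * n + j).choose (2 * c * n) : ℝ)) *
              Real.eulerMascheroniSeq (r * k + 2 * m * c * n + m)| <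
      ((m : ℝ) ^ m / ((m - 1).factorial : ℝ)) *
        (1 / ((4 : ℝ) ^ c *
          ((r : ℝ) + 1) ^ ((2 * m * c : ℝ) + (2 * m * c : ℝ) / (r : ℝ)))) ^ n := by
  obtain ⟨M, rfl⟩ : ∃ M, m = M + 1 := ⟨m - 1, by omega⟩
  have hr0 : (0 : ℝ) < r := by exact_mod_cast hr
  set a := c * n with ha
  set N := (M + 1) * (2 * a) with hN
  have eN : 2 * (M + 1) * c * n = N := by rw [hN, ha]; ring
  have ea : 2 * c * n = 2 * a := by rw [ha]; ring
  have hNe : Even N := by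
    rw [hN]
    exact (even_two_mul a).mul_left _
  rw [eN, ea, Nat.add_sub_cancel]
  simp_rw [mul_assoc _ c n, ← ha]
  set Q : ℕ → ℝ := fun k =>
    (-1 : ℝ) ^ k * (N.choose k : ℝ) *
      (blockPoly a (M + 1)).eval (-(((r * k + (N + (M + 1)) : ℕ) : ℝ) + 1)) with hQ
  have hsum : ∑ k ∈ Finset.range (N + 1), Q k = N.factorial * (r : ℝ) ^ N :=
    alternating_sum_eval_neg_arith hNe hr (N + (M + 1)) (monic_blockPoly a (M + 1))
      (natDegree_blockPoly a (M + 1))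
  have hA : (0 : ℝ) < N.factorial * (r : ℝ) ^ N := by positivity
  have hE : Real.eulerMascheroniConstant -
      (((2 * a).factorial : ℝ) ^ (M + 1) / ((N.factorial : ℝ) * (r : ℝ) ^ N)) *
        ∑ k ∈ Finset.range (N + 1), (-1 : ℝ) ^ k * (N.choose k : ℝ) *
          (∏ j ∈ Finset.Icc 1 (M + 1), ((r * k + (2 * j + 1) * a + j).choose (2 * a) : ℝ)) *
          Real.eulerMascheroniSeq (r * k + N + (M + 1)) =
      (∑ k ∈ Finset.range (N + 1), Q k * (Real.eulerMascheroniConstant -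
        Real.eulerMascheroniSeq (r * k + (N + (M + 1))))) / (N.factorial * (r : ℝ) ^ N) := by
    simp_rw [mul_sub]
    rw [Finset.sum_sub_distrib, ← Finset.sum_mul, hsum, sub_div, mul_div_cancel_left₀ _ hA.ne',
      div_mul_eq_mul_div, Finset.mul_sum]
    congr 2
    refine Finset.sum_congr rfl fun k _ => ?_
    simp only [hQ, hN, eval_blockPoly_neg, add_assoc]
    ring
  have hbound := abs_sum_mul_eulerMascheroniConstant_sub_le (Finset.range (N + 1)) Q
    (fun k => r * k + (N + (M + 1)))
    (((M + 1) * (2 * a + 1)).factorial / ((M + 1).factorial * (2 * a + 1 : ℝ) ^ (M + 1)) *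
      (1 / 4) ^ a * ((r : ℝ) / ((r : ℝ) + 1) ^ (1 + 1 / (r : ℝ))) ^ N) (M + 1) (fun t ht => by
      have := abs_alternating_sum_moment_le ht a M r fun x hx => mul_one_sub_pow_le hr hx
      rw [← hN] at this
      simpa only [hQ, mul_assoc] using this)
  -- The source of the strict inequality: `γ < 2/3` and `S_(M+1) > 0`.
  have hγ : Real.eulerMascheroniConstant - Real.eulerMascheroniSeq (M + 1) < 1 := by
    have h1 := Real.strictMono_eulerMascheroniSeq (Nat.succ_pos M)
    rw [Real.eulerMascheroniSeq_zero] at h1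
    have h2 := Real.eulerMascheroniConstant_lt_two_thirds
    have h3 : (0 : ℝ) < Real.eulerMascheroniSeq (M + 1) := h1
    linarith
  rw [hE, abs_div, abs_of_pos hA, div_lt_iff₀ hA]
  have hrate := rate_pow_eq c (M + 1) r n
  rw [← ha, ← hN] at hrate
  have hfac := factorial_ratio_le a M
  rw [← hN] at hfac
  set D : ℝ := ((M + 1) * (2 * a + 1)).factorial /
    ((M + 1).factorial * (2 * a + 1 : ℝ) ^ (M + 1)) with hD
  have hD0 : 0 < D := by positivity
  set R : ℝ := (1 / ((4 : ℝ) ^ c * ((r : ℝ) + 1) ^ ((2 * (M + 1 : ℕ) * c : ℝ) +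
    (2 * (M + 1 : ℕ) * c : ℝ) / (r : ℝ)))) ^ n with hR
  have hR0 : 0 < R := by positivity
  rw [div_le_iff₀ (by positivity)] at hfac
  calc _ ≤ _ := hbound
    _ = D * (R * (r : ℝ) ^ N) *
        (Real.eulerMascheroniConstant - Real.eulerMascheroniSeq (M + 1)) := by
      rw [← hrate, ← mul_assoc D, hD]
    _ < D * (R * (r : ℝ) ^ N) * 1 := mul_lt_mul_of_pos_left hγ (by positivity)
    _ ≤ (((M + 1 : ℕ) : ℝ) ^ (M + 1) / M.factorial * N.factorial) * (R * (r : ℝ) ^ N) := by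
      rw [mul_one]
      exact mul_le_mul_of_nonneg_right hfac (by positivity)
    _ = _ := by ring
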